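/- Let $A$ be a complex unital Banach algebra that is primitive, i.e. $\{0\}$ is the annihilator of a simple left $A$-module $A/L$ for some maximal left ideal $L$. Let $p\in A$ be a minimal idempotent, i.e. $p\neq 0$, $p^2=p$ and $pAp=\mathbb{C}p$, and let $\operatorname{soc}(A)$ be the socle of $A$, the sum of its minimal left ideals (a two-sided ideal). For $a\in A$ let $\widehat a$ be the bounded operator $y\mapsto ay$ on the Banach space $Ap$, let $L(Ap)$ be the algebra of all bounded operators on $Ap$, let $F_0(Ap)$ be its ideal of finite rank operators, and let $\mathfrak L_r:A\to L(Ap)$, $\mathfrak L_r(a)=\widehat a$, be the left regular representation. Assume that $$\mathfrak L_r(\operatorname{soc}(A))=F_0(Ap).$$ An element $x$ of a unital ring $R$ is called Drazin invertible in $R$ if there are $b\in R$ and $k\in\mathbb N$ with $bxb=b$, $xb=bx$ and $x^kbx=x^k$. An element $a\in A$ is called a B-Fredholm element of $A$ if its class is Drazin invertible in $A/\operatorname{soc}(A)$. A bounded operator $T$ on a Banach space $X$ is called a B-Fredholm operator if for some integer $n\ge 0$ the range $R(T^n)$ is closed and the operator $R(T^n)\to R(T^n)$ induced by $T$ is a Fredholm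 operator. Then the following two conditions are equivalent: (i) for every $a\in A$, if $\widehat a$ is a B-Fredholm operator on $Ap$, then $a$ is a B-Fredholm element of $A$; (ii) every element of the algebra $\mathfrak L_r(A)/F_0(Ap)$ that is Drazin invertible in $L(Ap)/F_0(Ap)$ is Drazin invertible in $\mathfrak L_r(A)/F_0(Ap)$. -/

import Mathlib

namespace BFred

/-- `a` is Drazin invertible: there are `b` and `k ∈ ℕ` with `bab = b`, `ab = ba`,
`a ^ k b a = a ^ k`. -/
def IsDrazinInvertible {R : Type*} [Ring R] (a : R) : Prop :=
  ∃ (b : R) (k : ℕ), b * a * b = b ∧ a * b = b * a ∧ a ^ k * b * a = a ^ k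

/-- `a` is a B-Fredholm element of `R` modulo the two-sided ideal `J`: its image in `R ⧸ J`
is Drazin invertible. -/
def IsBFredholmElement {R : Type*} [Ring R] (J : Ideal R) [J.IsTwoSided] (a : R) : Prop :=
  IsDrazinInvertible (Ideal.Quotient.mk J a)

/-- The ideal `P` is (left) primitive: the annihilator of the simple left module `R ⧸ L`,
for some maximal left ideal `L`. -/
def IsPrimitiveIdeal {R : Type*} [Ring R] (P : Ideal R) : Prop :=
  ∃ L : Ideal R, L.IsMaximal ∧ P = Module.annihilator R (R ⧸ L)

/-- A ring is primitive if `{0}` is a primitive ideal. -/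
def IsPrimitiveRing (R : Type*) [Ring R] : Prop :=
  IsPrimitiveIdeal (⊥ : Ideal R)

/-- The socle of `R`: the sum of all minimal left ideals (`Ideal R` is the type of left ideals;
the sum is `{0}` if there are no minimal left ideals). -/
def socle (R : Type*) [Ring R] : Ideal R :=
  sSup {I : Ideal R | IsAtom I}

/-- The socle is a two-sided ideal: if `I` is a minimal left ideal, then `I b` is either zero or
again a minimal left ideal. -/
instance socle_isTwoSided (R : Type*) [Ring R] : (socle R).IsTwoSided := by
  refine ⟨fun {a} b ha => ?_⟩
  have key : socle R ≤ Submodule.comap (LinearMap.toSpanSingleton R R b) (socle R) := by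
    refine sSup_le fun I hI => ?_
    have hs : IsSimpleModule R I := isSimpleModule_iff_isAtom.mpr hI
    let f : I →ₗ[R] R := (LinearMap.toSpanSingleton R R b).comp (Submodule.subtype I)
    suffices h : LinearMap.range f ≤ socle R from fun x hx => h ⟨⟨x, hx⟩, rfl⟩
    rcases LinearMap.injective_or_eq_zero f with hinj | hzero
    · refine le_sSup ?_
      have e := LinearEquiv.ofInjective f hinj
      exact isSimpleModule_iff_isAtom.mp (IsSimpleModule.congr e.symm)
    · rw [hzero, LinearMap.range_zero]
      exact bot_le
  have h := key ha
  simpa using h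

section FiniteRank

variable (X : Type*) [NormedAddCommGroup X] [NormedSpace ℂ X]

/-- `F₀(X)`: the ideal of finite rank operators in the algebra `L(X)` of bounded operators. -/
def finiteRank : Ideal (X →L[ℂ] X) where
  carrier := {T | FiniteDimensional ℂ (LinearMap.range (T : X →ₗ[ℂ] X))}
  zero_mem' := by
    change FiniteDimensional ℂ (LinearMap.range (0 : X →ₗ[ℂ] X))
    rw [LinearMap.range_zero]
    infer_instance
  add_mem' := by
    intro S T hS hT
    simp only [Set.mem_ofPred_eq] at hS hT ⊢
    refine Submodule.finiteDimensional_of_le (S₂ := LinearMap.range (S : X →ₗ[ℂ] X) ⊔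
      LinearMap.range (T : X →ₗ[ℂ] X)) ?_
    exact LinearMap.range_add_le _ _
  smul_mem' := by
    intro S T hT
    simp only [Set.mem_ofPred_eq] at hT ⊢
    have h : LinearMap.range ((S • T : X →L[ℂ] X) : X →ₗ[ℂ] X) =
        (LinearMap.range (T : X →ₗ[ℂ] X)).map (S : X →ₗ[ℂ] X) :=
      LinearMap.range_comp _ _
    rw [h]
    infer_instance

instance finiteRank_isTwoSided : (finiteRank X).IsTwoSided := by
  refine ⟨fun {T} S hT => ?_⟩
  have hT' : FiniteDimensional ℂ (LinearMap.range (T : X →ₗ[ℂ] X)) := hT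
  change FiniteDimensional ℂ (LinearMap.range ((T * S : X →L[ℂ] X) : X →ₗ[ℂ] X))
  exact Submodule.finiteDimensional_of_le
    (LinearMap.range_comp_le_range (S : X →ₗ[ℂ] X) (T : X →ₗ[ℂ] X))

variable {X}

theorem mapsTo_range_pow (T : X →L[ℂ] X) (n : ℕ) :
    ∀ x ∈ LinearMap.range ((T ^ n : X →L[ℂ] X) : X →ₗ[ℂ] X),
      T x ∈ LinearMap.range ((T ^ n : X →L[ℂ] X) : X →ₗ[ℂ] X) := by
  rintro _ ⟨y, rfl⟩
  refine ⟨T y, ?_⟩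
  change (T ^ n * T) y = (T * T ^ n) y
  rw [← pow_succ, ← pow_succ']

/-- `T_n`: the operator induced by `T` on the range `R(T ^ n)`. -/
def restrictRangePow (T : X →L[ℂ] X) (n : ℕ) :
    LinearMap.range ((T ^ n : X →L[ℂ] X) : X →ₗ[ℂ] X) →L[ℂ]
      LinearMap.range ((T ^ n : X →L[ℂ] X) : X →ₗ[ℂ] X) :=
  T.restrict (mapsTo_range_pow T n)

/-- `T` is a B-Fredholm operator: for some `n ≥ 0` the range of `T ^ n` is closed and the operator
induced by `T` on this range is a Fredholm operator. -/
def IsBFredholmOperator (T : X →L[ℂ] X) : Prop :=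
  ∃ n : ℕ, IsClosed (LinearMap.range ((T ^ n : X →L[ℂ] X) : X →ₗ[ℂ] X) : Set X) ∧
    (restrictRangePow T n).IsFredholm

end FiniteRank

section Representation

variable {A : Type*} [NormedRing A] [NormedAlgebra ℂ A]

/-- `p` is a minimal idempotent: a nonzero idempotent with `pAp = ℂp`. -/
def IsMinimalIdempotent (p : A) : Prop :=
  p ≠ 0 ∧ p * p = p ∧ Set.range (fun a : A => p * a * p) = Set.range (fun c : ℂ => c • p)

/-- The left ideal `Ap = {ap : a ∈ A}`, as a normed space with the norm of `A`. -/
noncomputable def leftIdeal (p : A) : Submodule ℂ A :=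
  LinearMap.range (LinearMap.mulRight ℂ p)

theorem mul_mem_leftIdeal (p a : A) : ∀ y ∈ leftIdeal p, ContinuousLinearMap.mul ℂ A a y ∈
    leftIdeal p := by
  rintro _ ⟨b, rfl⟩
  exact ⟨a * b, by simp [mul_assoc]⟩

/-- The left regular representation `A → L(Ap)`, which sends `a` to the operator `y ↦ ay`. -/
noncomputable def leftRegular (p : A) : A →ₐ[ℂ] (leftIdeal p →L[ℂ] leftIdeal p) where
  toFun a := (ContinuousLinearMap.mul ℂ A a).restrict (mul_mem_leftIdeal p a)
  map_one' := by ext y; simp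
  map_mul' a b := by ext y; simp [mul_assoc]
  map_zero' := by ext y; simp
  map_add' a b := by ext y; simp
  commutes' c := by ext y; simp [Algebra.algebraMap_eq_smul_one]

theorem leftRegular_apply (p a : A) (y : leftIdeal p) :
    ((leftRegular p a y : leftIdeal p) : A) = a * y := rfl

/-- The algebra of operators `{y ↦ ay : a ∈ A}`, the image of the left regular representation
(as a ring: Drazin invertibility does not involve the scalars). -/
noncomputable def image (p : A) : Subring (leftIdeal p →L[ℂ] leftIdeal p) :=
  (leftRegular p : A →+* (leftIdeal p →L[ℂ] leftIdeal p)).range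

/-- `F₀(Ap)` as an ideal of the image of the left regular representation (its trace on the image,
which is `F₀(Ap)` itself as soon as the image contains all finite rank operators). -/
noncomputable def finiteRankInImage (p : A) : Ideal (image p) :=
  (finiteRank (leftIdeal p)).comap (image p).subtype

instance finiteRankInImage_isTwoSided (p : A) : (finiteRankInImage p).IsTwoSided :=
  inferInstanceAs ((finiteRank (leftIdeal p)).comap (image p).subtype).IsTwoSided

/-- The homomorphism from (image of `A` in `L(Ap)`) `/ F₀(Ap)` to `L(Ap) / F₀(Ap)` induced by the
inclusion. -/
noncomputable def imageQuotientInclusion (p : A) :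
    image p ⧸ finiteRankInImage p →+*
      (leftIdeal p →L[ℂ] leftIdeal p) ⧸ finiteRank (leftIdeal p) :=
  Ideal.quotientMap (finiteRank (leftIdeal p)) (image p).subtype le_rfl

theorem imageQuotientInclusion_injective (p : A) :
    Function.Injective (imageQuotientInclusion p) :=
  Ideal.quotientMap_injective

end Representation

end BFred

/-! The equivalence holds element by element. By an Atkinson-type theorem
(`isBFredholmOperator_iff`), the operator of `a` is B-Fredholm exactly when its class modulo finite
rank operators is Drazin invertible. Primitivity makes the left regular representation faithful
(`leftRegular_injective`), so the socle hypothesis gives it kernel `socle A` modulo finite rank.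
Hence `A ⧸ socle A` is isomorphic to `image p ⧸ finiteRankInImage p`
(`isBFredholmElement_socle_iff`), and both conditions make the same assertion about each `a`. -/

namespace BFred

/-! ### Drazin invertibility by two one-sided power identities -/

section Drazin

theorem IsDrazinInvertible.map {R S : Type*} [Ring R] [Ring S] (f : R →+* S) {a : R}
    (h : IsDrazinInvertible a) : IsDrazinInvertible (f a) := by
  obtain ⟨b, k, h₁, h₂, h₃⟩ := h
  refine ⟨f b, k, ?_, ?_, ?_⟩
  · rw [← map_mul, ← map_mul, h₁]
  · rw [← map_mul, ← map_mul, h₂]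
  · rw [← map_pow, ← map_mul, ← map_mul, h₃]

theorem isDrazinInvertible_ringEquiv_iff {R S : Type*} [Ring R] [Ring S] (e : R ≃+* S) {a : R} :
    IsDrazinInvertible (e a) ↔ IsDrazinInvertible a :=
  ⟨fun h => by simpa using h.map (e.symm : S →+* R), fun h => h.map (e : R →+* S)⟩

theorem pow_add_mul_pow_of_pow_succ_mul {R : Type*} [Ring R] {x b : R} {n : ℕ}
    (h : x ^ (n + 1) * b = x ^ n) (j : ℕ) : x ^ (n + j) * b ^ j = x ^ n := by
  induction j with
  | zero => simp
  | succ j ih =>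
    have : x ^ (n + (j + 1)) * b ^ (j + 1) = x ^ j * (x ^ (n + 1) * b) * b ^ j := by
      rw [pow_succ' b, show n + (j + 1) = j + (n + 1) by ring, pow_add x j]
      simp only [mul_assoc]
    rw [this, h, ← pow_add, add_comm j n, ih]

theorem pow_mul_pow_add_of_mul_pow_succ {R : Type*} [Ring R] {x b : R} {n : ℕ}
    (h : b * x ^ (n + 1) = x ^ n) (j : ℕ) : b ^ j * x ^ (n + j) = x ^ n := by
  induction j with
  | zero => simp
  | succ j ih =>
    have : b ^ (j + 1) * x ^ (n + (j + 1)) = b ^ j * (b * x ^ (n + 1)) * x ^ j := by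
      rw [pow_succ b, show n + (j + 1) = (n + 1) + j by ring, pow_add x (n + 1)]
      simp only [mul_assoc]
    rw [this, h, mul_assoc, ← pow_add, ih]

/-- Both products equal `b * x ^ (n + 1) * b`. This replaces commutation of `x` with `b`, which is
not assumed. -/
theorem commute_pow_of_pow_succ {R : Type*} [Ring R] {x b : R} {n : ℕ}
    (hr : x ^ (n + 1) * b = x ^ n) (hl : b * x ^ (n + 1) = x ^ n) : Commute (x ^ n) b := by
  change x ^ n * b = b * x ^ n
  conv_lhs => rw [← hl]
  rw [mul_assoc, hr]

/-- An element `x` with `x ^ (n + 1) * b = x ^ n = b * x ^ (n + 1)` is Drazin invertible, with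
Drazin inverse `x ^ n * b ^ (n + 1)`. -/
theorem isDrazinInvertible_of_pow_succ {R : Type*} [Ring R] {x b : R} {n : ℕ}
    (hr : x ^ (n + 1) * b = x ^ n) (hl : b * x ^ (n + 1) = x ^ n) : IsDrazinInvertible x := by
  have hc := commute_pow_of_pow_succ hr hl
  have hxd : x * (x ^ n * b ^ (n + 1)) = x ^ n * b ^ n := by
    rw [pow_succ' b, ← mul_assoc, ← pow_succ', ← mul_assoc, hr]
  have hdx : x ^ n * b ^ (n + 1) * x = x ^ n * b ^ n := by
    rw [(hc.pow_right (n + 1)).eq, mul_assoc, ← pow_succ, pow_succ b, mul_assoc, hl,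
      (hc.pow_right n).eq]
  have hn : x ^ n * (x ^ n * b ^ n) = x ^ n := by
    rw [← mul_assoc, ← pow_add, pow_add_mul_pow_of_pow_succ_mul hr]
  refine ⟨x ^ n * b ^ (n + 1), n, ?_, hxd.trans hdx.symm, ?_⟩
  · rw [hdx, ← mul_assoc, mul_assoc (x ^ n), ← (hc.pow_right n).eq, hn]
  · rw [mul_assoc, hdx, hn]

theorem IsDrazinInvertible.exists_pow_succ {R : Type*} [Ring R] {x : R}
    (h : IsDrazinInvertible x) :
    ∃ (b : R) (n : ℕ), x ^ (n + 1) * b = x ^ n ∧ b * x ^ (n + 1) = x ^ n := by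
  obtain ⟨b, k, -, h₂, h₃⟩ := h
  have hc : Commute x b := h₂
  refine ⟨b, k, ?_, ?_⟩
  · rw [pow_succ, mul_assoc, h₂, ← mul_assoc, h₃]
  · rw [pow_succ, ← mul_assoc, ← (hc.pow_left k).eq, h₃]

end Drazin

/-! ### B-Fredholm operators and Drazin invertibility modulo finite rank -/

section FiniteRank

variable {X : Type*} [NormedAddCommGroup X] [NormedSpace ℂ X]

theorem mem_finiteRank {T : X →L[ℂ] X} :
    T ∈ finiteRank X ↔ FiniteDimensional ℂ (LinearMap.range (T : X →ₗ[ℂ] X)) := Iff.rfl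

theorem isQuasiInverse_iff_mem_finiteRank {S T : X →L[ℂ] X} :
    (S : X →ₗ[ℂ] X).IsQuasiInverse (T : X →ₗ[ℂ] X) ↔
      S * T - 1 ∈ finiteRank X ∧ T * S - 1 ∈ finiteRank X := by
  have key (U : X →L[ℂ] X) : (U : X →ₗ[ℂ] X).HasFiniteRange ↔ U ∈ finiteRank X := by
    rw [LinearMap.hasFiniteRange_iff_range, Submodule.fg_iff_finiteDimensional, mem_finiteRank]
  rw [← key, ← key]
  exact and_congr (LinearMap.FiniteRangeSetoid.equiv_iff_hasFiniteRange ..)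
    (LinearMap.FiniteRangeSetoid.equiv_iff_hasFiniteRange ..)

theorem isFredholm_iff_exists_mem_finiteRank {T : X →L[ℂ] X} :
    T.IsFredholm ↔ ∃ S : X →L[ℂ] X, S * T - 1 ∈ finiteRank X ∧ T * S - 1 ∈ finiteRank X := by
  simp only [ContinuousLinearMap.isFredholm_iff_exists_isQuasiInverse,
    isQuasiInverse_iff_mem_finiteRank]

/-- An operator that factors through a finite rank operator has finite rank. -/
theorem comp_comp_mem_finiteRank {Y : Type*} [NormedAddCommGroup Y] [NormedSpace ℂ Y]
    {F : Y →L[ℂ] Y} (hF : F ∈ finiteRank Y) (V : Y →L[ℂ] X) (U : X →L[ℂ] Y) :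
    V ∘L F ∘L U ∈ finiteRank X := by
  have : FiniteDimensional ℂ (LinearMap.range (F : Y →ₗ[ℂ] Y)) := hF
  rw [mem_finiteRank]
  refine Submodule.finiteDimensional_of_le
    (S₂ := (LinearMap.range (F : Y →ₗ[ℂ] Y)).map (V : Y →ₗ[ℂ] X)) ?_
  rintro _ ⟨x, rfl⟩
  exact ⟨F (U x), ⟨U x, rfl⟩, rfl⟩

/-- The power `T ^ n` as an operator onto its range. -/
def toRangePow (T : X →L[ℂ] X) (n : ℕ) :
    X →L[ℂ] LinearMap.range ((T ^ n : X →L[ℂ] X) : X →ₗ[ℂ] X) :=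
  (T ^ n).codRestrict _ fun x => ⟨x, rfl⟩

theorem coe_toRangePow (T : X →L[ℂ] X) (n : ℕ) (x : X) : (toRangePow T n x : X) = (T ^ n) x := rfl

theorem coe_restrictRangePow_pow (T : X →L[ℂ] X) (n m : ℕ)
    (y : LinearMap.range ((T ^ n : X →L[ℂ] X) : X →ₗ[ℂ] X)) :
    ((restrictRangePow T n ^ m) y : X) = (T ^ m) y := by
  induction m generalizing y with
  | zero => rfl
  | succ m ih =>
    rw [pow_succ, pow_succ, mul_apply_eq_comp, ih]
    rfl

theorem pow_mul_pow_sub_one_mem {R : Type*} [Ring R] {J : Ideal R} [J.IsTwoSided] {a b : R}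
    (h : a * b - 1 ∈ J) (m : ℕ) : a ^ m * b ^ m - 1 ∈ J := by
  rw [← Ideal.Quotient.eq, map_mul, map_one] at h ⊢
  rw [map_pow, map_pow]
  exact pow_mul_pow_eq_one m h

/-- If `S` inverts the induced operator `T_n` modulo finite rank, then `S ^ (n + 1)` inverts `T_n ^
(n + 1)`. Precomposing with `T ^ n : X → R(T ^ n)` gives an operator `B` on `X` satisfying both
power identities. -/
theorem IsDrazinInvertible.of_isBFredholmOperator {T : X →L[ℂ] X} (h : IsBFredholmOperator T) :
    IsDrazinInvertible (Ideal.Quotient.mk (finiteRank X) T) := by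
  obtain ⟨n, -, hF⟩ := h
  obtain ⟨S, hl, hr⟩ := isFredholm_iff_exists_mem_finiteRank.1 hF
  have hl' := pow_mul_pow_sub_one_mem hl (n + 1)
  have hr' := pow_mul_pow_sub_one_mem hr (n + 1)
  let ι := (LinearMap.range ((T ^ n : X →L[ℂ] X) : X →ₗ[ℂ] X)).subtypeL
  let B : X →L[ℂ] X := ι ∘L (S ^ (n + 1)) ∘L toRangePow T n
  refine isDrazinInvertible_of_pow_succ (n := n) (b := Ideal.Quotient.mk (finiteRank X) B) ?_ ?_
  · rw [← map_pow, ← map_pow, ← map_mul, Ideal.Quotient.eq]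
    convert comp_comp_mem_finiteRank hr' ι (toRangePow T n) using 1
    ext x
    change (T ^ (n + 1)) ((S ^ (n + 1)) (toRangePow T n x)) - (T ^ n) x =
      ((restrictRangePow T n ^ (n + 1)) ((S ^ (n + 1)) (toRangePow T n x)) : X) - (T ^ n) x
    rw [coe_restrictRangePow_pow]
  · rw [← map_pow, ← map_pow, ← map_mul, Ideal.Quotient.eq]
    convert comp_comp_mem_finiteRank hl' ι (toRangePow T n) using 1
    have hT (x : X) : toRangePow T n ((T ^ (n + 1)) x) =
        (restrictRangePow T n ^ (n + 1)) (toRangePow T n x) := by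
      ext
      rw [coe_restrictRangePow_pow, coe_toRangePow, coe_toRangePow,
        ← mul_apply_eq_comp, ← mul_apply_eq_comp, ← pow_add, ← pow_add,
        add_comm]
    ext x
    change ((S ^ (n + 1)) (toRangePow T n ((T ^ (n + 1)) x)) : X) - (T ^ n) x =
      ((S ^ (n + 1)) ((restrictRangePow T n ^ (n + 1)) (toRangePow T n x)) : X) - (T ^ n) x
    rw [hT]

/-- The range of an operator with a generalized inverse modulo finite rank operators is closed. -/
theorem isClosed_range_of_mul_mul_sub_mem {W V : X →L[ℂ] X}
    (h : W * V * W - W ∈ finiteRank X) :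
    IsClosed (LinearMap.range (W : X →ₗ[ℂ] X) : Set X) := by
  set F := W * V * W - W with hF
  have : FiniteDimensional ℂ (LinearMap.range (F : X →ₗ[ℂ] X)) := h
  -- The fixed space of `W * V` is a closed subspace of the range of `W`. It contains `W (ker F)`,
  -- and `ker F` has finite codimension, so the range is `N` plus a finite-dimensional space.
  let N : Submodule ℂ X := LinearMap.ker ((W * V - 1 : X →L[ℂ] X) : X →ₗ[ℂ] X)
  have hN : IsClosed (N : Set X) := (W * V - 1).isClosed_ker
  have hNW : N ≤ LinearMap.range (W : X →ₗ[ℂ] X) := fun y hy => ⟨V y, sub_eq_zero.1 hy⟩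
  obtain ⟨G, hG⟩ := Submodule.exists_isCompl (LinearMap.ker (F : X →ₗ[ℂ] X))
  have hGf : FiniteDimensional ℂ G :=
    Module.Finite.equiv ((LinearMap.quotKerEquivRange (F : X →ₗ[ℂ] X)).symm.trans
      (Submodule.quotientEquivOfIsCompl _ _ hG))
  have hrange : LinearMap.range (W : X →ₗ[ℂ] X) = N ⊔ G.map (W : X →ₗ[ℂ] X) := by
    refine le_antisymm ?_ (sup_le hNW LinearMap.map_le_range)
    rw [LinearMap.range_eq_map, ← hG.sup_eq_top, Submodule.map_sup]
    refine sup_le_sup_right ?_ _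
    rintro _ ⟨x, hx, rfl⟩
    exact hx
  rw [hrange]
  exact Submodule.isClosed_sup_finiteDimensional _ _ hN

/-- Every vector of `R(T ^ n)` is some `T ^ n x`, so the range of `U` embeds in that of `F`. Finite
rank on `R(T ^ n)` can thus be tested on `X`. -/
theorem mem_finiteRank_of_coe_apply_toRangePow {T F : X →L[ℂ] X} (hF : F ∈ finiteRank X) {n : ℕ}
    {U : LinearMap.range ((T ^ n : X →L[ℂ] X) : X →ₗ[ℂ] X) →L[ℂ]
      LinearMap.range ((T ^ n : X →L[ℂ] X) : X →ₗ[ℂ] X)}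
    (h : ∀ x, (U (toRangePow T n x) : X) = F x) : U ∈ finiteRank _ := by
  have : FiniteDimensional ℂ (LinearMap.range (F : X →ₗ[ℂ] X)) := hF
  rw [mem_finiteRank]
  let R := LinearMap.range ((T ^ n : X →L[ℂ] X) : X →ₗ[ℂ] X)
  have hle : (LinearMap.range (U : R →ₗ[ℂ] R)).map R.subtype ≤
      LinearMap.range (F : X →ₗ[ℂ] X) := by
    rintro _ ⟨_, ⟨⟨_, x, rfl⟩, rfl⟩, rfl⟩
    exact ⟨x, (h x).symm⟩
  have := Submodule.finiteDimensional_of_le hle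
  exact Module.Finite.equiv
    (Submodule.equivMapOfInjective R.subtype R.subtype_injective
      (LinearMap.range (U : R →ₗ[ℂ] R))).symm

/-- The operator `T ^ n * B ^ (n + 1)` maps into `R(T ^ n)`; its restriction there inverts `T_n`
modulo finite rank, because the classes of `T ^ n` and `B` commute. -/
theorem IsBFredholmOperator.of_isDrazinInvertible {T : X →L[ℂ] X}
    (h : IsDrazinInvertible (Ideal.Quotient.mk (finiteRank X) T)) : IsBFredholmOperator T := by
  obtain ⟨b, n, hr, hl⟩ := h.exists_pow_succ
  obtain ⟨B, rfl⟩ := Ideal.Quotient.mk_surjective b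
  have hc := commute_pow_of_pow_succ hr hl
  refine ⟨n, isClosed_range_of_mul_mul_sub_mem (V := B ^ n) ?_,
    isFredholm_iff_exists_mem_finiteRank.2
      ⟨toRangePow T n ∘L (B ^ (n + 1)) ∘L Submodule.subtypeL _, ?_, ?_⟩⟩
  · rw [← Ideal.Quotient.eq, map_mul, map_mul, map_pow, map_pow, mul_assoc,
      ← (hc.pow_right n).eq, ← mul_assoc, ← pow_add, pow_add_mul_pow_of_pow_succ_mul hr]
  · refine mem_finiteRank_of_coe_apply_toRangePow
      (F := T ^ n * B ^ (n + 1) * T ^ (n + 1) - T ^ n) ?_ fun x => ?_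
    · rw [← Ideal.Quotient.eq, map_mul, map_mul, map_pow, map_pow, map_pow,
        (hc.pow_right (n + 1)).eq, mul_assoc, ← pow_add, pow_mul_pow_add_of_mul_pow_succ hl]
    · change (T ^ n) ((B ^ (n + 1)) (T ((T ^ n) x))) - (T ^ n) x = _
      rw [pow_succ' T n]
      rfl
  · refine mem_finiteRank_of_coe_apply_toRangePow
      (F := T ^ (n + 1) * B ^ (n + 1) * T ^ n - T ^ n) ?_ fun x => ?_
    · rw [← Ideal.Quotient.eq, map_mul, map_mul, map_pow, map_pow, map_pow, mul_assoc,
        ← (hc.pow_right (n + 1)).eq, ← mul_assoc, ← pow_add, add_comm (n + 1),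
        pow_add_mul_pow_of_pow_succ_mul hr]
    · change T ((T ^ n) ((B ^ (n + 1)) ((T ^ n) x))) - (T ^ n) x = _
      rw [pow_succ' T n]
      rfl

/-- An operator is B-Fredholm if and only if it is Drazin invertible modulo finite rank
operators. -/
theorem isBFredholmOperator_iff {T : X →L[ℂ] X} :
    IsBFredholmOperator T ↔ IsDrazinInvertible (Ideal.Quotient.mk (finiteRank X) T) :=
  ⟨.of_isBFredholmOperator, .of_isDrazinInvertible⟩

end FiniteRank

/-! ### The left regular representation and the socle -/

section Representation

variable {A : Type*} [NormedRing A] [NormedAlgebra ℂ A]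

/-- As `p` acts nontrivially on the simple module `R ⧸ L`, some vector `p * c + L` is nonzero and
generates it. Since `a` kills `R * p`, it annihilates the whole module. -/
theorem IsPrimitiveRing.eq_zero_of_mul_mul_eq_zero {R : Type*} [Ring R] (hR : IsPrimitiveRing R)
    {a p : R} (hp : p ≠ 0) (h : ∀ b, a * (b * p) = 0) : a = 0 := by
  obtain ⟨L, hL, hann⟩ := hR
  have hp' : p ∉ Module.annihilator R (R ⧸ L) := by rwa [← hann, Ideal.mem_bot]
  have hmem (r : R) : r ∈ Module.annihilator R (R ⧸ L) ↔ ∀ c, r * c ∈ L := by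
    rw [Module.mem_annihilator]
    refine ⟨fun H c => ?_, fun H m => ?_⟩
    · exact (Submodule.Quotient.mk_eq_zero L).1 (H (Submodule.Quotient.mk c))
    · obtain ⟨c, rfl⟩ := Submodule.Quotient.mk_surjective L m
      exact (Submodule.Quotient.mk_eq_zero L).2 (H c)
  rw [hmem, not_forall] at hp'
  obtain ⟨c, hc⟩ := hp'
  rw [← Ideal.mem_bot, hann, hmem]
  intro x
  -- Maximality of `L` together with `p * c ∉ L`.
  have htop : L ⊔ Ideal.span {p * c} = ⊤ := by
    refine hL.1.2 _ (lt_of_le_of_ne le_sup_left fun H => hc ?_)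
    rw [H]
    exact Ideal.mem_sup_right (Ideal.mem_span_singleton_self _)
  obtain ⟨l, hl, y, hy, rfl⟩ := Submodule.mem_sup.1 (htop ▸ Submodule.mem_top : x ∈ _)
  obtain ⟨d, rfl⟩ := Ideal.mem_span_singleton'.1 hy
  have : a * (d * (p * c)) = 0 := by
    rw [← mul_assoc d, ← mul_assoc, h, zero_mul]
  rw [mul_add, this, add_zero]
  exact L.mul_mem_left a hl

theorem leftRegular_injective (hA : IsPrimitiveRing A) {p : A} (hp : p ≠ 0) :
    Function.Injective (leftRegular p) := by
  refine (injective_iff_map_eq_zero (leftRegular p)).2 fun a ha => ?_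
  refine hA.eq_zero_of_mul_mul_eq_zero hp fun b => ?_
  have := leftRegular_apply p a ⟨b * p, b, rfl⟩
  rw [ha] at this
  exact this.symm

theorem leftRegular_mem_finiteRank_iff {p : A} (hinj : Function.Injective (leftRegular p))
    (hsoc : leftRegular p '' (socle A : Set A) =
      (finiteRank (leftIdeal p) : Set (leftIdeal p →L[ℂ] leftIdeal p))) {a : A} :
    leftRegular p a ∈ finiteRank (leftIdeal p) ↔ a ∈ socle A := by
  rw [← SetLike.mem_coe, ← hsoc, hinj.mem_set_image, SetLike.mem_coe]

/-- The left regular representation, as a homomorphism onto its image modulo finite rank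
operators. -/
noncomputable def leftRegularQuotient (p : A) : A →+* image p ⧸ finiteRankInImage p :=
  (Ideal.Quotient.mk (finiteRankInImage p)).comp
    (leftRegular p : A →+* (leftIdeal p →L[ℂ] leftIdeal p)).rangeRestrict

theorem leftRegularQuotient_surjective (p : A) : Function.Surjective (leftRegularQuotient p) :=
  Ideal.Quotient.mk_surjective.comp (RingHom.rangeRestrict_surjective _)

theorem imageQuotientInclusion_leftRegularQuotient (p a : A) :
    imageQuotientInclusion p (leftRegularQuotient p a) =
      Ideal.Quotient.mk (finiteRank (leftIdeal p)) (leftRegular p a) := rfl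

theorem leftRegularQuotient_eq_zero_iff {p a : A} :
    leftRegularQuotient p a = 0 ↔ leftRegular p a ∈ finiteRank (leftIdeal p) :=
  Ideal.Quotient.eq_zero_iff_mem

theorem isBFredholmElement_socle_iff {p : A} (hinj : Function.Injective (leftRegular p))
    (hsoc : leftRegular p '' (socle A : Set A) =
      (finiteRank (leftIdeal p) : Set (leftIdeal p →L[ℂ] leftIdeal p))) {a : A} :
    IsBFredholmElement (socle A) a ↔ IsDrazinInvertible (leftRegularQuotient p a) := by
  have hker (x : A) : leftRegularQuotient p x = 0 ↔ x ∈ socle A :=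
    leftRegularQuotient_eq_zero_iff.trans (leftRegular_mem_finiteRank_iff hinj hsoc)
  let f : A ⧸ socle A →+* image p ⧸ finiteRankInImage p :=
    Ideal.Quotient.lift (socle A) (leftRegularQuotient p) fun x hx => (hker x).2 hx
  have hf : Function.Bijective f := by
    refine ⟨(injective_iff_map_eq_zero f).2 fun y hy => ?_, fun y => ?_⟩
    · obtain ⟨x, rfl⟩ := Ideal.Quotient.mk_surjective y
      exact Ideal.Quotient.eq_zero_iff_mem.2 ((hker x).1 hy)
    · obtain ⟨x, rfl⟩ := leftRegularQuotient_surjective p y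
      exact ⟨Ideal.Quotient.mk _ x, rfl⟩
  exact (isDrazinInvertible_ringEquiv_iff (RingEquiv.ofBijective f hf)).symm

end Representation

end BFred

theorem theorem3p3 {A : Type*} [NormedRing A] [NormedAlgebra ℂ A] [CompleteSpace A]
    (hA : BFred.IsPrimitiveRing A) (p : A) (hp : BFred.IsMinimalIdempotent p)
    (hsoc : BFred.leftRegular p '' (BFred.socle A : Set A) =
      (BFred.finiteRank (BFred.leftIdeal p) : Set (BFred.leftIdeal p →L[ℂ] BFred.leftIdeal p))) :
    (∀ a : A, BFred.IsBFredholmOperator (BFred.leftRegular p a) →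
        BFred.IsBFredholmElement (BFred.socle A) a) ↔
    (∀ x : BFred.image p ⧸ BFred.finiteRankInImage p,
        BFred.IsDrazinInvertible (BFred.imageQuotientInclusion p x) →
          BFred.IsDrazinInvertible x) := by
  -- Of minimality, only `p ≠ 0` enters here.
  have hinj := BFred.leftRegular_injective hA hp.1
  -- Each `x` is the class of the operator of some `a`, so both conditions become statements about
  -- `a`.
  rw [(BFred.leftRegularQuotient_surjective p).forall]
  refine forall_congr' fun a => ?_
  rw [BFred.isBFredholmOperator_iff, BFred.isBFredholmElement_socle_iff hinj hsoc,
    BFred.imageQuotientInclusion_leftRegularQuotient]
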